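/- Let $A$ be a finite abelian group, let $A^\omega=\bigoplus_{k=0}^{\infty}A$ be the direct sum of countably many copies of $A$, and for integers $n\ge 0$ let $\Phi_n=\{(a_k)_{k\ge0}\in A^\omega: a_k=0\text{ for }k\ge n\}\cong A^n$. Let $S=(S^a)_{a\in A^\omega}$ and $T=(T^a)_{a\in A^\omega}$ be two commuting measure-preserving actions of $A^\omega$ on a probability space $(X,\mathcal F,\mu)$ with $(X,\mathcal F)$ standard Borel; that is, all $S^a,T^a:X\to X$ are measurable and preserve $\mu$, $S^0=T^0=\mathrm{id}$, and $S^aS^b=S^{a+b}$, $T^aT^b=T^{a+b}$, $S^aT^b=T^bS^a$ for all $a,b\in A^\omega$. For measurable $f,g:X\to\mathbb C$ put $$M_n(f,g)=\frac1{|\Phi_n|}\sum_{a\in\Phi_n}(f\circ S^a)(g\circ T^a),\qquad n\ge 0.$$ For every $2\le p<\infty$ there is a finite constant $C_p$, depending only on $p$, such that for all $A,X,\mu,S,T,f,g$ as above the following hold. (1) $$\sup_{m,\;0\le n_0<n_1<\dots<n_m}\ \sum_{j=1}^m\big\|M_{n_{j-1}}(f,g)-M_{n_j}(f,g)\big\|_{L^p(\mu)}^p\le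 C_p\,\|f\|_{L^{2p}(\mu)}^p\,\|g\|_{L^{2p}(\mu)}^p,$$ where the right-hand side may be $+\infty$ and $\infty\cdot 0=0$. (2) For every $\varepsilon>0$ the number of $\varepsilon$-jumps in $L^p$ of the sequence $(M_n(f,g))_{n\ge0}$, that is, the supremum in $\{0,1,2,\dots,\infty\}$ of the integers $m\ge 0$ for which there are indices $n_1<n_1'\le n_2<n_2'\le\dots\le n_m<n_m'$ with $\|M_{n_j}(f,g)-M_{n_j'}(f,g)\|_{L^p(\mu)}\ge\varepsilon$ for $j=1,\dots,m$, is at most $C_p\,\varepsilon^{-p}\,\|f\|_{L^{2p}(\mu)}^p\,\|g\|_{L^{2p}(\mu)}^p$. (3) If $f,g\in L^{2p}(\mu)$, then all $M_n(f,g)$ lie in $L^p(\mu)$ and the sequence $(M_n(f,g))_{n\ge0}$ converges in $L^p(\mu)$. -/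

import Mathlib

open MeasureTheory Filter Topology
open scoped ENNReal NNReal

noncomputable section

namespace DoubleAverages

/-- The group `A^ω`, the direct sum of countably many copies of `A`: finitely supported sequences
`a = (a_k)_{k ≥ 0}` in `A` with coordinatewise addition. -/
abbrev Omega (A : Type*) [AddCommGroup A] : Type _ := ℕ →₀ A

section Folner

variable (A : Type*) [AddCommGroup A]

/-- The subset `Φ_n = {a ∈ A^ω : a_k = 0 for all k ≥ n}` of `A^ω`. -/
def folnerSet (n : ℕ) : Set (Omega A) := {a | ∀ k, n ≤ k → a k = 0}

theorem folnerSet_finite [Finite A] (n : ℕ) : (folnerSet A n).Finite := by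
  refine Set.Finite.of_injOn (t := (Set.univ : Set (Fin n → A)))
    (f := fun (a : Omega A) (i : Fin n) => a i) (fun _ _ => Set.mem_univ _) ?_ Set.finite_univ
  intro a ha b hb hab
  ext k
  by_cases hk : k < n
  · exact congrFun hab ⟨k, hk⟩
  · rw [ha k (not_lt.mp hk), hb k (not_lt.mp hk)]

/-- `Φ_n` as a finite set, for a finite group `A`. -/
def folner [Finite A] (n : ℕ) : Finset (Omega A) := (folnerSet_finite A n).toFinset

end Folner

/-- `S = (S^a)` is a measure preserving action of `A^ω` on `(X, μ)`: all `S^a` are measurable and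
preserve `μ`, `S^0` is the identity, and `S^(a + b) = S^a S^b`. -/
structure IsMeasurePreservingAction {A X : Type*} [AddCommGroup A] [MeasurableSpace X]
    (μ : Measure X) (S : Omega A → X → X) : Prop where
  measurePreserving : ∀ a, MeasurePreserving (S a) μ μ
  map_zero : S 0 = id
  map_add : ∀ a b, S (a + b) = S a ∘ S b

/-- The double average `M_n(f, g) = |Φ_n|⁻¹ ∑_{a ∈ Φ_n} (f ∘ S^a) (g ∘ T^a)`. -/
def doubleAverage {A X : Type*} [AddCommGroup A] [Finite A] (S T : Omega A → X → X)
    (f g : X → ℂ) (n : ℕ) : X → ℂ :=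
  fun x => ((folner A n).card : ℂ)⁻¹ * ∑ a ∈ folner A n, f (S a x) * g (T a x)

/-- The supremum, over all `m` and all `n_0 < n_1 < ⋯ < n_m`, of
`∑_{j=1}^m ‖M_{n_{j-1}} - M_{n_j}‖_p ^ p`, for a sequence `M_0, M_1, …` of functions. -/
def normVariation {X : Type*} [MeasurableSpace X] (μ : Measure X) (p : ℝ) (M : ℕ → X → ℂ) :
    ℝ≥0∞ :=
  ⨆ (m : ℕ) (n : Fin (m + 1) → ℕ) (_ : StrictMono n),
    ∑ j : Fin m, eLpNorm (M (n j.castSucc) - M (n j.succ)) (ENNReal.ofReal p) μ ^ p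

/-- There are indices `n_1 < n'_1 ≤ n_2 < n'_2 ≤ ⋯ ≤ n_m < n'_m` such that
`‖M_{n_j} - M_{n'_j}‖_p ≥ ε` for every `j`. -/
def HasJumps {X : Type*} [MeasurableSpace X] (μ : Measure X) (p : ℝ) (M : ℕ → X → ℂ) (ε : ℝ)
    (m : ℕ) : Prop :=
  ∃ n n' : Fin m → ℕ, (∀ j, n j < n' j) ∧ (∀ i j, i < j → n' i ≤ n j) ∧
    ∀ j, ENNReal.ofReal ε ≤ eLpNorm (M (n j) - M (n' j)) (ENNReal.ofReal p) μ

/-- The number of `ε`-jumps in `L^p` of a sequence of functions: the largest `m` for which there are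
`m` successive jumps, and infinity if there is no largest one. -/
def numJumps {X : Type*} [MeasurableSpace X] (μ : Measure X) (p : ℝ) (M : ℕ → X → ℂ) (ε : ℝ) :
    ℕ∞ :=
  ⨆ (m : ℕ) (_ : HasJumps μ p M ε m), (m : ℕ∞)

end DoubleAverages

end

/-!
Suppose first that `S^a` and `T^a` are the translations by `σ a` and `τ a` on a finite abelian
group. For nested subgroups `H ≤ K`, expanding the inner product of `M_H(F, G)` with `M_K(F, G)`
gives the average over `b ∈ K` of the pairings of the multiplicative derivative of `F` in the
direction `σ b` with the average over `(τ - σ) H` of that of `G` in the direction `τ b`. Hence, up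
to the difference of their energies, the squared distance between `M_H(F, G)` and `M_K(F, G)` is
controlled by what these derivatives lose in passing from averages over `(τ - σ) H` to averages
over `(τ - σ) K`. This loss is the decrease of a box form in one of its two subgroups; as the box
form is decreasing in both of them, the losses telescope along an increasing sequence of subgroups.
The result is the variation estimate for `p = 2`, which is interpolated with the trivial `L^∞`
bound by the three lines theorem.

On a general space the finite estimate is applied along the orbits of `H_m × H_m` under
`(a, b) ↦ S^a T^b`; invariance of the measure and the Cauchy–Schwarz inequality turn it into an
estimate for the integrals. Jumps are counted by the variation, and a sequence of finite variation
is Cauchy, since otherwise it would have arbitrarily many jumps of a fixed size.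
-/

noncomputable section

namespace DoubleAverages

open Finset ComplexConjugate
open scoped BigOperators

section Translates

variable {V W : Type*} [AddCommGroup V] [AddCommGroup W]

/-- The average of `f` over the translates by `σ H`, for a homomorphism `σ : V → W` and a finite
subgroup `H` of `V`. -/
def translateAvg (σ : V →+ W) (H : AddSubgroup V) [Fintype H] (f : W → ℂ) (x : W) : ℂ :=
  𝔼 a : H, f (x + σ a)

variable (σ : V →+ W) {H K : AddSubgroup V} [Fintype H] [Fintype K]

theorem expect_addSubgroup_bot {M : Type*} [AddCommMonoid M] [Module ℚ≥0 M] (f : V → M) :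
    𝔼 a : (⊥ : AddSubgroup V), f a = f 0 :=
  expect_singleton _ _

theorem translateAvg_bot (f : W → ℂ) : translateAvg σ ⊥ f = f := by
  funext x
  rw [translateAvg, expect_addSubgroup_bot fun a => f (x + σ a), map_zero, add_zero]

theorem translateAvg_conj (f : W → ℂ) (x : W) :
    translateAvg σ H (fun y => conj (f y)) x = conj (translateAvg σ H f x) :=
  (map_expect (starRingEnd ℂ) _ _).symm

theorem translateAvg_add_mem (f : W → ℂ) (x : W) {a : V} (ha : a ∈ H) :
    translateAvg σ H f (x + σ a) = translateAvg σ H f x :=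
  Fintype.expect_equiv (Equiv.addLeft (⟨a, ha⟩ : H)) _ _ fun b => by simp [add_assoc]

theorem translateAvg_translateAvg_of_le (h : H ≤ K) (f : W → ℂ) :
    translateAvg σ H (translateAvg σ K f) = translateAvg σ K f := by
  funext x
  rw [translateAvg, expect_congr rfl fun (a : H) _ => translateAvg_add_mem σ f x (h a.2),
    Fintype.expect_const]

variable [Fintype W]

theorem sum_mul_translateAvg (f g : W → ℂ) :
    ∑ x, f x * translateAvg σ H g x = ∑ x, translateAvg σ H f x * g x := by
  simp only [translateAvg, mul_expect, expect_mul, ← expect_sum_comm]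
  refine Fintype.expect_equiv (Equiv.neg H) _ _ fun a => ?_
  exact Fintype.sum_equiv (Equiv.addRight (σ a)) _ _ fun x => by simp

theorem sum_translateAvg_mul_translateAvg_of_le (h : H ≤ K) (f g : W → ℂ) :
    ∑ x, translateAvg σ H f x * translateAvg σ K g x = ∑ x, f x * translateAvg σ K g x := by
  rw [← sum_mul_translateAvg, translateAvg_translateAvg_of_le σ h]

theorem sum_translateAvg_sub_mul_sub (h : H ≤ K) (f g : W → ℂ) :
    ∑ x, (translateAvg σ H f x - translateAvg σ K f x) *
        (translateAvg σ H g x - translateAvg σ K g x) =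
      ∑ x, f x * translateAvg σ H g x - ∑ x, f x * translateAvg σ K g x := by
  have cross : ∑ x, translateAvg σ K f x * translateAvg σ H g x =
      ∑ x, f x * translateAvg σ K g x := by
    rw [sum_mul_translateAvg, translateAvg_translateAvg_of_le σ h, sum_mul_translateAvg]
  simp only [mul_sub, sub_mul, sum_sub_distrib, cross,
    sum_translateAvg_mul_translateAvg_of_le σ le_rfl, sum_translateAvg_mul_translateAvg_of_le σ h]
  ring

theorem ofReal_sum_norm_translateAvg_sq (f : W → ℂ) :
    ((∑ x, ‖translateAvg σ H f x‖ ^ 2 : ℝ) : ℂ) =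
      ∑ x, f x * translateAvg σ H (fun y => conj (f y)) x := by
  rw [← sum_translateAvg_mul_translateAvg_of_le σ le_rfl]
  push_cast
  exact sum_congr rfl fun x _ => by rw [translateAvg_conj, Complex.mul_conj']

theorem sum_norm_translateAvg_sub_sq (h : H ≤ K) (f : W → ℂ) :
    ∑ x, ‖translateAvg σ H f x - translateAvg σ K f x‖ ^ 2 =
      ∑ x, ‖translateAvg σ H f x‖ ^ 2 - ∑ x, ‖translateAvg σ K f x‖ ^ 2 := by
  rw [← Complex.ofReal_inj, Complex.ofReal_sub, ofReal_sum_norm_translateAvg_sq,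
    ofReal_sum_norm_translateAvg_sq, ← sum_translateAvg_sub_mul_sub σ h]
  push_cast
  exact sum_congr rfl fun x _ => by
    rw [translateAvg_conj, translateAvg_conj, ← map_sub, Complex.mul_conj']

theorem sum_norm_translateAvg_sq_anti (h : H ≤ K) (f : W → ℂ) :
    ∑ x, ‖translateAvg σ K f x‖ ^ 2 ≤ ∑ x, ‖translateAvg σ H f x‖ ^ 2 := by
  rw [← sub_nonneg, ← sum_norm_translateAvg_sub_sq σ h]
  positivity

end Translates

section BoxForm

variable {V W : Type*} [AddCommGroup V] [AddCommGroup W]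

/-- The multiplicative derivative of `f` in the direction `v`. -/
def multDeriv (v : W) (f : W → ℂ) (x : W) : ℂ := f x * conj (f (x + v))

variable [Fintype W]

/-- The box form of `f` with one edge in `σ H` and the other one in `ρ K`: the average of
`∑ x, f x * conj (f (x + σ a)) * conj (f (x + ρ b)) * f (x + σ a + ρ b)` over `a ∈ H`, `b ∈ K`,
written as the energy of the multiplicative derivatives of `f`. -/
def boxForm (σ : V →+ W) (H : AddSubgroup V) [Fintype H] (ρ : V →+ W) (K : AddSubgroup V)
    [Fintype K] (f : W → ℂ) : ℝ :=
  𝔼 a : H, ∑ x, ‖translateAvg ρ K (multDeriv (σ a) f) x‖ ^ 2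

variable (σ ρ : V →+ W) {H H' K K' : AddSubgroup V}
  [Fintype H] [Fintype H'] [Fintype K] [Fintype K']

theorem boxForm_nonneg (f : W → ℂ) : 0 ≤ boxForm σ H ρ K f :=
  expect_nonneg fun a _ => by positivity

theorem ofReal_boxForm (f : W → ℂ) :
    (boxForm σ H ρ K f : ℂ) = 𝔼 a : H, 𝔼 b : K, ∑ x,
      f x * conj (f (x + σ a)) * (conj (f (x + ρ b)) * f (x + σ a + ρ b)) := by
  rw [boxForm, ← Complex.ofRealHom_eq_coe, map_expect Complex.ofRealHom]
  refine expect_congr rfl fun a _ => ?_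
  rw [Complex.ofRealHom_eq_coe, ofReal_sum_norm_translateAvg_sq]
  simp only [translateAvg, mul_expect, ← expect_sum_comm, multDeriv, map_mul, Complex.conj_conj,
    add_right_comm _ (ρ _) (σ a)]

theorem boxForm_comm (f : W → ℂ) : boxForm σ H ρ K f = boxForm ρ K σ H f := by
  rw [← Complex.ofReal_inj, ofReal_boxForm, ofReal_boxForm, expect_comm]
  refine expect_congr rfl fun b _ => expect_congr rfl fun a _ => sum_congr rfl fun x _ => ?_
  rw [add_right_comm, mul_mul_mul_comm]

theorem boxForm_anti_right (h : K ≤ K') (f : W → ℂ) :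
    boxForm σ H ρ K' f ≤ boxForm σ H ρ K f :=
  expect_le_expect fun _ _ => sum_norm_translateAvg_sq_anti ρ h _

theorem boxForm_anti_left (h : H ≤ H') (f : W → ℂ) :
    boxForm σ H' ρ K f ≤ boxForm σ H ρ K f := by
  rw [boxForm_comm σ, boxForm_comm σ]
  exact boxForm_anti_right ρ σ h f

theorem boxForm_bot (f : W → ℂ) : boxForm σ ⊥ ρ ⊥ f = ∑ x, ‖f x‖ ^ 4 := by
  rw [boxForm, expect_addSubgroup_bot fun a => ∑ x, ‖translateAvg ρ ⊥ (multDeriv (σ a) f) x‖ ^ 2]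
  refine sum_congr rfl fun x _ => ?_
  rw [translateAvg_bot, multDeriv, map_zero, add_zero, Complex.mul_conj', norm_pow,
    Complex.norm_real, norm_norm, ← pow_mul]

theorem boxForm_le (f : W → ℂ) : boxForm σ H ρ K f ≤ ∑ x, ‖f x‖ ^ 4 :=
  boxForm_bot σ ρ f ▸ (boxForm_anti_left σ ρ bot_le f).trans (boxForm_anti_right σ ρ bot_le f)

/-- The energy which the multiplicative derivatives of `f` in the directions of `σ K` lose when
their averages over `ρ H` are replaced by those over `ρ K`. -/
def energyLoss (σ ρ : V →+ W) (H K : AddSubgroup V) [Fintype H] [Fintype K] (f : W → ℂ) : ℝ :=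
  𝔼 b : K, ∑ x, ‖translateAvg ρ H (multDeriv (σ b) f) x -
    translateAvg ρ K (multDeriv (σ b) f) x‖ ^ 2

theorem energyLoss_nonneg (f : W → ℂ) : 0 ≤ energyLoss σ ρ H K f :=
  expect_nonneg fun b _ => by positivity

theorem energyLoss_le (h : H ≤ K) (f : W → ℂ) :
    energyLoss σ ρ H K f ≤ boxForm σ H ρ H f - boxForm σ K ρ K f :=
  calc energyLoss σ ρ H K f = boxForm σ K ρ H f - boxForm σ K ρ K f := by
        simp only [energyLoss, boxForm, ← expect_sub_distrib, sum_norm_translateAvg_sub_sq ρ h]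
    _ ≤ boxForm σ H ρ H f - boxForm σ K ρ K f :=
        sub_le_sub_right (boxForm_anti_left σ ρ h f) _

theorem sum_energyLoss_le {H : ℕ → AddSubgroup V} [∀ j, Fintype (H j)] (hH : Monotone H)
    (f : W → ℂ) (m : ℕ) :
    ∑ j ∈ range m, energyLoss σ ρ (H j) (H (j + 1)) f ≤ ∑ x, ‖f x‖ ^ 4 :=
  calc ∑ j ∈ range m, energyLoss σ ρ (H j) (H (j + 1)) f
      ≤ ∑ j ∈ range m, (boxForm σ (H j) ρ (H j) f - boxForm σ (H (j + 1)) ρ (H (j + 1)) f) :=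
        sum_le_sum fun j _ => energyLoss_le σ ρ (hH j.le_succ) f
    _ = boxForm σ (H 0) ρ (H 0) f - boxForm σ (H m) ρ (H m) f :=
        sum_range_sub' (fun j => boxForm σ (H j) ρ (H j) f) m
    _ ≤ ∑ x, ‖f x‖ ^ 4 :=
        (sub_le_self _ (boxForm_nonneg σ ρ f)).trans (boxForm_le σ ρ f)

end BoxForm

section BilinearAverages

theorem expect_mul_le_sqrt_mul_sqrt {ι : Type*} (s : Finset ι) (f g : ι → ℝ) :
    𝔼 i ∈ s, f i * g i ≤ √(𝔼 i ∈ s, f i ^ 2) * √(𝔼 i ∈ s, g i ^ 2) := by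
  rw [← Real.sqrt_mul (expect_nonneg fun i _ => sq_nonneg (f i))]
  exact Real.le_sqrt_of_sq_le (expect_mul_sq_le_sq_mul_sq s f g)

variable {V W : Type*} [AddCommGroup V] [AddCommGroup W]

/-- The double average over `H` of functions on `W`, shifted along `σ` and `τ` respectively. -/
def bilinAvg (σ τ : V →+ W) (H : AddSubgroup V) [Fintype H] (F G : W → ℂ) (w : W) : ℂ :=
  𝔼 a : H, F (w + σ a) * G (w + τ a)

variable (σ τ : V →+ W) {H K : AddSubgroup V} [Fintype H] [Fintype K]

theorem bilinAvg_add_mem (F G : W → ℂ) (w : W) {a : V} (ha : a ∈ H) :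
    𝔼 b : H, F (w + σ a + σ b) * G (w + τ a + τ b) = bilinAvg σ τ H F G w :=
  Fintype.expect_equiv (Equiv.addLeft (⟨a, ha⟩ : H)) _ _ fun b => by simp [add_assoc]

theorem norm_bilinAvg_le_one {F G : W → ℂ} (hF : ∀ w, ‖F w‖ ≤ 1) (hG : ∀ w, ‖G w‖ ≤ 1) (w : W) :
    ‖bilinAvg σ τ H F G w‖ ≤ 1 := by
  refine (RCLike.norm_expect_le (K := ℂ)).trans (expect_le univ_nonempty fun a _ => ?_)
  rw [norm_mul]
  exact mul_le_one₀ (hF _) (norm_nonneg _) (hG _)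

theorem norm_bilinAvg_sq_le (F G : W → ℂ) (w : W) :
    ‖bilinAvg σ τ H F G w‖ ^ 2 ≤ 𝔼 a : H, ‖F (w + σ a)‖ ^ 2 * ‖G (w + τ a)‖ ^ 2 :=
  calc ‖bilinAvg σ τ H F G w‖ ^ 2 ≤ (𝔼 a : H, ‖F (w + σ a) * G (w + τ a)‖ * 1) ^ 2 := by
        simp only [mul_one]
        exact pow_le_pow_left₀ (norm_nonneg _) (RCLike.norm_expect_le (K := ℂ)) 2
    _ ≤ (𝔼 a : H, ‖F (w + σ a) * G (w + τ a)‖ ^ 2) * 𝔼 _a : H, (1 : ℝ) ^ 2 :=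
        expect_mul_sq_le_sq_mul_sq _ _ _
    _ = 𝔼 a : H, ‖F (w + σ a)‖ ^ 2 * ‖G (w + τ a)‖ ^ 2 := by
        simp only [one_pow, Fintype.expect_const, mul_one, norm_mul, mul_pow]

variable [Fintype W]

theorem sum_norm_bilinAvg_sq_le (F G : W → ℂ) :
    ∑ w, ‖bilinAvg σ τ H F G w‖ ^ 2 ≤ √(∑ w, ‖F w‖ ^ 4) * √(∑ w, ‖G w‖ ^ 4) := by
  have cauchySchwarz (a : H) : ∑ w, ‖F (w + σ a)‖ ^ 2 * ‖G (w + τ a)‖ ^ 2 ≤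
      √(∑ w, ‖F w‖ ^ 4) * √(∑ w, ‖G w‖ ^ 4) := by
    refine (Real.sum_mul_le_sqrt_mul_sqrt _ _ _).trans_eq ?_
    simp only [← pow_mul]
    congr 2
    · exact Fintype.sum_equiv (Equiv.addRight (σ a)) _ _ fun w => rfl
    · exact Fintype.sum_equiv (Equiv.addRight (τ a)) _ _ fun w => rfl
  calc ∑ w, ‖bilinAvg σ τ H F G w‖ ^ 2
      ≤ ∑ w, 𝔼 a : H, ‖F (w + σ a)‖ ^ 2 * ‖G (w + τ a)‖ ^ 2 :=
        sum_le_sum fun w _ => norm_bilinAvg_sq_le σ τ F G w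
    _ = 𝔼 a : H, ∑ w, ‖F (w + σ a)‖ ^ 2 * ‖G (w + τ a)‖ ^ 2 := (expect_sum_comm _ _ _).symm
    _ ≤ √(∑ w, ‖F w‖ ^ 4) * √(∑ w, ‖G w‖ ^ 4) :=
        expect_le univ_nonempty fun a _ => cauchySchwarz a

theorem sum_bilinAvg_mul_conj_bilinAvg (h : H ≤ K) (F G : W → ℂ) :
    ∑ w, bilinAvg σ τ H F G w * conj (bilinAvg σ τ K F G w) =
      𝔼 b : K, ∑ w, multDeriv (σ b) F w * translateAvg (τ - σ) H (multDeriv (τ b) G) w := by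
  have expand (w : W) : bilinAvg σ τ H F G w * conj (bilinAvg σ τ K F G w) =
      𝔼 a : H, 𝔼 b : K, multDeriv (σ b) F (w + σ a) * multDeriv (τ b) G (w + τ a) := by
    rw [bilinAvg, expect_mul]
    refine expect_congr rfl fun a _ => ?_
    rw [← bilinAvg_add_mem σ τ F G w (h a.2), map_expect (starRingEnd ℂ), mul_expect]
    exact expect_congr rfl fun b _ => by rw [map_mul, mul_mul_mul_comm, multDeriv, multDeriv]
  simp only [expand, translateAvg, mul_expect, ← expect_sum_comm]
  rw [expect_comm]
  refine expect_congr rfl fun b _ => expect_congr rfl fun a _ => ?_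
  exact Fintype.sum_equiv (Equiv.addRight (σ a)) _ _ fun w => by simp

theorem norm_sum_bilinAvg_sub_mul_conj_le (h : H ≤ K) (F G : W → ℂ) :
    ‖∑ w, (bilinAvg σ τ H F G w - bilinAvg σ τ K F G w) * conj (bilinAvg σ τ K F G w)‖ ≤
      √(energyLoss σ (τ - σ) H K F) * √(energyLoss τ (τ - σ) H K G) := by
  set ρ := τ - σ
  let d (v : W) (f : W → ℂ) (w : W) : ℂ :=
    translateAvg ρ H (multDeriv v f) w - translateAvg ρ K (multDeriv v f) w
  have hd : ∑ w, (bilinAvg σ τ H F G w - bilinAvg σ τ K F G w) * conj (bilinAvg σ τ K F G w) =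
      𝔼 b : K, ∑ w, d (σ b) F w * d (τ b) G w := by
    simp only [sub_mul, sum_sub_distrib, sum_bilinAvg_mul_conj_bilinAvg σ τ h,
      sum_bilinAvg_mul_conj_bilinAvg σ τ le_rfl, ← expect_sub_distrib]
    exact expect_congr rfl fun b _ => (sum_translateAvg_sub_mul_sub ρ h _ _).symm
  have cauchySchwarz (b : K) : ‖∑ w, d (σ b) F w * d (τ b) G w‖ ≤
      √(∑ w, ‖d (σ b) F w‖ ^ 2) * √(∑ w, ‖d (τ b) G w‖ ^ 2) := by
    refine (norm_sum_le _ _).trans ?_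
    simp only [norm_mul]
    exact Real.sum_mul_le_sqrt_mul_sqrt _ _ _
  calc ‖_‖ = ‖𝔼 b : K, ∑ w, d (σ b) F w * d (τ b) G w‖ := by rw [hd]
    _ ≤ 𝔼 b : K, √(∑ w, ‖d (σ b) F w‖ ^ 2) * √(∑ w, ‖d (τ b) G w‖ ^ 2) :=
        (RCLike.norm_expect_le (K := ℂ)).trans (expect_le_expect fun b _ => cauchySchwarz b)
    _ ≤ √(𝔼 b : K, √(∑ w, ‖d (σ b) F w‖ ^ 2) ^ 2) *
          √(𝔼 b : K, √(∑ w, ‖d (τ b) G w‖ ^ 2) ^ 2) := expect_mul_le_sqrt_mul_sqrt _ _ _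
    _ = √(energyLoss σ ρ H K F) * √(energyLoss τ ρ H K G) := by
        simp only [Real.sq_sqrt (sum_nonneg fun w _ => sq_nonneg ‖d _ _ w‖), d, energyLoss]

theorem norm_sub_sq_eq_sub_two_mul_re (z w : ℂ) :
    ‖z - w‖ ^ 2 = ‖z‖ ^ 2 - ‖w‖ ^ 2 - 2 * ((z - w) * conj w).re := by
  simp only [Complex.sq_norm, Complex.normSq_apply, Complex.sub_re, Complex.sub_im,
    Complex.mul_re, Complex.conj_re, Complex.conj_im]
  ring

theorem sum_norm_bilinAvg_sub_sq_le (h : H ≤ K) (F G : W → ℂ) :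
    ∑ w, ‖bilinAvg σ τ H F G w - bilinAvg σ τ K F G w‖ ^ 2 ≤
      ∑ w, ‖bilinAvg σ τ H F G w‖ ^ 2 - ∑ w, ‖bilinAvg σ τ K F G w‖ ^ 2 +
        2 * (√(energyLoss σ (τ - σ) H K F) * √(energyLoss τ (τ - σ) H K G)) := by
  have cross := (Complex.abs_re_le_norm _).trans (norm_sum_bilinAvg_sub_mul_conj_le σ τ h F G)
  rw [Complex.re_sum] at cross
  simp only [norm_sub_sq_eq_sub_two_mul_re, sum_sub_distrib, ← mul_sum]
  linarith [(abs_le.1 cross).1]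

theorem sum_range_norm_bilinAvg_sub_sq_le {H : ℕ → AddSubgroup V} [∀ j, Fintype (H j)]
    (hH : Monotone H) (F G : W → ℂ) (m : ℕ) :
    ∑ j ∈ range m, ∑ w, ‖bilinAvg σ τ (H j) F G w - bilinAvg σ τ (H (j + 1)) F G w‖ ^ 2 ≤
      3 * (√(∑ w, ‖F w‖ ^ 4) * √(∑ w, ‖G w‖ ^ 4)) := by
  set B := √(∑ w, ‖F w‖ ^ 4) * √(∑ w, ‖G w‖ ^ 4)
  let E (j : ℕ) : ℝ := ∑ w, ‖bilinAvg σ τ (H j) F G w‖ ^ 2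
  let eF (j : ℕ) : ℝ := energyLoss σ (τ - σ) (H j) (H (j + 1)) F
  let eG (j : ℕ) : ℝ := energyLoss τ (τ - σ) (H j) (H (j + 1)) G
  have energy : ∑ j ∈ range m, (E j - E (j + 1)) ≤ B := by
    rw [sum_range_sub']
    have : 0 ≤ E m := by positivity
    linarith [sum_norm_bilinAvg_sq_le σ τ (H := H 0) F G]
  have cross : ∑ j ∈ range m, √(eF j) * √(eG j) ≤ B :=
    (Real.sum_sqrt_mul_sqrt_le _ (fun _ => energyLoss_nonneg _ _ _)
      fun _ => energyLoss_nonneg _ _ _).trans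
      (mul_le_mul (Real.sqrt_le_sqrt (sum_energyLoss_le _ _ hH F m))
        (Real.sqrt_le_sqrt (sum_energyLoss_le _ _ hH G m)) (Real.sqrt_nonneg _)
        (Real.sqrt_nonneg _))
  calc _ ≤ ∑ j ∈ range m, (E j - E (j + 1) + 2 * (√(eF j) * √(eG j))) :=
        sum_le_sum fun j _ => sum_norm_bilinAvg_sub_sq_le σ τ (hH j.le_succ) F G
    _ = ∑ j ∈ range m, (E j - E (j + 1)) + 2 * ∑ j ∈ range m, √(eF j) * √(eG j) := by
        rw [sum_add_distrib, mul_sum]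
    _ ≤ 3 * B := by linarith

end BilinearAverages

section Interpolation

/-- The complex power `sgn w * |w| ^ s`, the analytic family of the interpolation argument. As
`0 / 0 = 0`, it vanishes at `w = 0` for every `s`. -/
def phasePow (w s : ℂ) : ℂ := w / ‖w‖ * (‖w‖ : ℂ) ^ s

theorem norm_phasePow_le (w s : ℂ) : ‖phasePow w s‖ ≤ ‖w‖ ^ s.re := by
  rcases eq_or_ne w 0 with rfl | hw
  · simpa [phasePow] using Real.rpow_nonneg le_rfl _
  · have hw' : 0 < ‖w‖ := norm_pos_iff.2 hw
    rw [phasePow, norm_mul, Complex.norm_cpow_eq_rpow_re_of_pos hw', norm_div, Complex.norm_real,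
      norm_norm, div_self hw'.ne', one_mul]

theorem norm_phasePow_le_max_rpow (w : ℂ) {s : ℂ} {r : ℝ} (h₀ : 0 ≤ s.re) (h : s.re ≤ r) :
    ‖phasePow w s‖ ≤ max 1 ‖w‖ ^ r :=
  (norm_phasePow_le w s).trans <|
    (Real.rpow_le_rpow (norm_nonneg w) (le_max_right 1 _) h₀).trans
      (Real.rpow_le_rpow_of_exponent_le (le_max_left 1 _) h)

theorem norm_phasePow_pow_le (w s : ℂ) (n : ℕ) : ‖phasePow w s‖ ^ n ≤ ‖w‖ ^ (s.re * n) := by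
  rw [Real.rpow_mul_natCast (norm_nonneg w)]
  exact pow_le_pow_left₀ (norm_nonneg _) (norm_phasePow_le w s) n

theorem differentiable_phasePow (w : ℂ) : Differentiable ℂ (phasePow w) := by
  rcases eq_or_ne w 0 with rfl | hw
  · simp [funext fun s => show phasePow 0 s = 0 by simp [phasePow]]
  · intro s
    have : (‖w‖ : ℂ) ≠ 0 := by simpa using hw
    exact (differentiableAt_id.const_cpow (.inl this)).const_mul _

theorem phasePow_one (w : ℂ) : phasePow w 1 = w := by
  rw [phasePow, Complex.cpow_one]
  exact div_mul_cancel_of_imp fun h => by simpa using h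

theorem mul_phasePow_conj (w : ℂ) {p : ℝ} (hp : p ≠ 0) :
    w * phasePow (conj w) (p - 1) = (‖w‖ ^ p : ℝ) := by
  rcases eq_or_ne w 0 with rfl | hw
  · simp [Real.zero_rpow hp]
  · have hw' : (‖w‖ : ℂ) ≠ 0 := by simpa using hw
    rw [phasePow, Complex.norm_conj, Complex.cpow_sub _ _ hw', Complex.cpow_one,
      Complex.ofReal_cpow (norm_nonneg w), mul_left_comm, ← mul_assoc, div_mul_eq_mul_div,
      Complex.conj_mul', div_mul_div_comm, ← sq, mul_div_cancel_left₀ _ (pow_ne_zero 2 hw')]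

open Complex.HadamardThreeLines Asymptotics

variable {ι κ Ω : Type*} [Fintype Ω]

/-- The entire function to which the three lines theorem is applied: the pairing of
`D (sgn F * |F| ^ (p z / 2)) (sgn G * |G| ^ (p z / 2))` with `sgn H * |H| ^ (p - p z / 2)`, where
`H` is the conjugate of `D F G`. -/
def interpolant (D : (ι → ℂ) →ₗ[ℂ] (κ → ℂ) →ₗ[ℂ] (Ω → ℂ)) (p : ℝ) (F : ι → ℂ) (G : κ → ℂ)
    (z : ℂ) : ℂ :=
  ∑ ω, D (fun i => phasePow (F i) ((p / 2 : ℝ) * z)) (fun k => phasePow (G k) ((p / 2 : ℝ) * z)) ω *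
    phasePow (conj (D F G ω)) (p - (p / 2 : ℝ) * z)

variable (D : (ι → ℂ) →ₗ[ℂ] (κ → ℂ) →ₗ[ℂ] (Ω → ℂ)) {p : ℝ} (F : ι → ℂ) (G : κ → ℂ)

theorem differentiable_interpolant [Finite ι] [Finite κ] :
    Differentiable ℂ (interpolant D p F G) := by
  obtain ⟨_⟩ := nonempty_fintype ι
  obtain ⟨_⟩ := nonempty_fintype κ
  have hpow (w : ℂ) : Differentiable ℂ fun z => phasePow w ((p / 2 : ℝ) * z) :=
    (differentiable_phasePow w).comp (differentiable_id.const_mul _)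
  have hD : Differentiable ℂ fun z => D (fun i => phasePow (F i) ((p / 2 : ℝ) * z))
      fun k => phasePow (G k) ((p / 2 : ℝ) * z) :=
    D.toContinuousBilinearMap.isBoundedBilinearMap.differentiable.comp
      ((differentiable_pi.2 fun i => hpow (F i)).prodMk (differentiable_pi.2 fun k => hpow (G k)))
  exact Differentiable.fun_sum fun ω _ => (differentiable_pi.1 hD ω).mul
    ((differentiable_phasePow _).comp ((differentiable_id.const_mul _).const_sub _))

theorem bddAbove_norm_interpolant [Finite ι] [Finite κ] (hp : 0 ≤ p) :
    BddAbove ((norm ∘ interpolant D p F G) '' verticalClosedStrip 0 1) := by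
  obtain ⟨_⟩ := nonempty_fintype ι
  obtain ⟨_⟩ := nonempty_fintype κ
  have strip {z : ℂ} (hz : z ∈ verticalClosedStrip 0 1) :
      0 ≤ p / 2 * z.re ∧ p / 2 * z.re ≤ p :=
    ⟨mul_nonneg (by positivity) hz.1, by nlinarith [hz.1, hz.2]⟩
  have hpow (w : ℂ) : (fun z => phasePow w ((p / 2 : ℝ) * z))
      =O[𝓟 (verticalClosedStrip 0 1)] fun _ => (1 : ℝ) :=
    isBigO_principal.2 ⟨max 1 ‖w‖ ^ p, fun z hz => by
      simpa using norm_phasePow_le_max_rpow w (by simpa using (strip hz).1)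
        (by simpa using (strip hz).2)⟩
  have hdual (w : ℂ) : (fun z => phasePow w (p - (p / 2 : ℝ) * z))
      =O[𝓟 (verticalClosedStrip 0 1)] fun _ => (1 : ℝ) :=
    isBigO_principal.2 ⟨max 1 ‖w‖ ^ p, fun z hz => by
      simpa using norm_phasePow_le_max_rpow w (by simpa using (strip hz).2)
        (by simpa using (strip hz).1)⟩
  have hD : (fun z => D (fun i => phasePow (F i) ((p / 2 : ℝ) * z))
      fun k => phasePow (G k) ((p / 2 : ℝ) * z))
        =O[𝓟 (verticalClosedStrip 0 1)] fun _ => (1 : ℝ) := by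
    have := (isBigO_pi.2 fun i => hpow (F i)).norm_left.mul
      (isBigO_pi.2 fun k => hpow (G k)).norm_left
    rw [mul_one] at this
    exact D.toContinuousBilinearMap.isBoundedBilinearMap.isBigO_comp.trans this
  have hΦ : interpolant D p F G =O[𝓟 (verticalClosedStrip 0 1)] fun _ => (1 : ℝ) :=
    IsBigO.fun_sum fun ω _ => by simpa using (isBigO_pi.1 hD ω).mul (hdual _)
  obtain ⟨c, hc⟩ := isBigO_principal.1 hΦ
  exact ⟨c, Set.forall_mem_image.2 fun z hz => by simpa using hc z hz⟩

theorem norm_interpolant_le_of_re_eq_zero {B : ℝ}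
    (bound : ∀ F G, (∀ i, ‖F i‖ ≤ 1) → (∀ k, ‖G k‖ ≤ 1) → ∀ ω, ‖D F G ω‖ ≤ B)
    {z : ℂ} (hz : z.re = 0) :
    ‖interpolant D p F G z‖ ≤ B * ∑ ω, ‖D F G ω‖ ^ p := by
  have le_one (w : ℂ) : ‖phasePow w ((p / 2 : ℝ) * z)‖ ≤ 1 := by
    simpa [hz] using norm_phasePow_le w ((p / 2 : ℝ) * z)
  have dual_le (ω : Ω) : ‖phasePow (conj (D F G ω)) (p - (p / 2 : ℝ) * z)‖ ≤ ‖D F G ω‖ ^ p := by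
    simpa [hz] using norm_phasePow_le (conj (D F G ω)) (p - (p / 2 : ℝ) * z)
  rw [mul_sum]
  refine (norm_sum_le _ _).trans (sum_le_sum fun ω _ => ?_)
  rw [norm_mul]
  have hB := bound _ _ (fun i => le_one (F i)) (fun k => le_one (G k)) ω
  exact mul_le_mul hB (dual_le ω) (norm_nonneg _) ((norm_nonneg _).trans hB)

theorem norm_interpolant_le_of_re_eq_one [Fintype ι] [Fintype κ] {C : ℝ} (hC : 0 ≤ C)
    (bound_two : ∀ F G, ∑ ω, ‖D F G ω‖ ^ 2 ≤ C * (√(∑ i, ‖F i‖ ^ 4) * √(∑ k, ‖G k‖ ^ 4)))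
    {z : ℂ} (hz : z.re = 1) :
    ‖interpolant D p F G z‖ ≤
      √(C * (√(∑ i, ‖F i‖ ^ (2 * p)) * √(∑ k, ‖G k‖ ^ (2 * p)))) * √(∑ ω, ‖D F G ω‖ ^ p) := by
  have pow_four (w : ℂ) : ‖phasePow w ((p / 2 : ℝ) * z)‖ ^ 4 ≤ ‖w‖ ^ (2 * p) := by
    refine (norm_phasePow_pow_le w _ 4).trans_eq ?_
    rw [Complex.re_ofReal_mul, hz]
    congr 1
    push_cast
    ring
  have dual_sq (ω : Ω) :
      ‖phasePow (conj (D F G ω)) (p - (p / 2 : ℝ) * z)‖ ^ 2 ≤ ‖D F G ω‖ ^ p := by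
    refine (norm_phasePow_pow_le _ _ 2).trans_eq ?_
    rw [Complex.norm_conj, Complex.sub_re, Complex.ofReal_re, Complex.re_ofReal_mul, hz]
    congr 1
    push_cast
    ring
  refine (norm_sum_le _ _).trans ?_
  simp only [norm_mul]
  refine (Real.sum_mul_le_sqrt_mul_sqrt _ _ _).trans ?_
  gcongr ?_ * √?_
  · refine Real.sqrt_le_sqrt ((bound_two _ _).trans ?_)
    gcongr with i _ k _
    · exact pow_four (F i)
    · exact pow_four (G k)
  · exact sum_le_sum fun ω _ => dual_sq ω

theorem interpolant_two_div (hp : p ≠ 0) :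
    interpolant D p F G ((2 / p : ℝ) : ℂ) = (∑ ω, ‖D F G ω‖ ^ p : ℝ) := by
  have exponent : ((p / 2 : ℝ) : ℂ) * ((2 / p : ℝ) : ℂ) = 1 := by
    rw [← Complex.ofReal_mul, div_mul_div_cancel₀ two_ne_zero, div_self hp, Complex.ofReal_one]
  simp only [interpolant, exponent, phasePow_one, mul_phasePow_conj _ hp, Complex.ofReal_sum]

theorem le_mul_of_le_rpow_mul_rpow {Y B E : ℝ} (hp : 0 < p) (hY : 0 ≤ Y) (hB : 0 ≤ B)
    (hE : 0 ≤ E) (h : Y ≤ (B * Y) ^ (1 - 2 / p) * (√E * √Y) ^ (2 / p)) :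
    Y ≤ B ^ (p - 2) * E := by
  rcases hY.eq_or_lt with rfl | hY₀
  · positivity
  have hpow : Y ^ p ≤ (B ^ (p - 2) * E) * Y ^ (p - 1) :=
    calc Y ^ p ≤ ((B * Y) ^ (1 - 2 / p) * (√E * √Y) ^ (2 / p)) ^ p :=
          Real.rpow_le_rpow hY h hp.le
      _ = (B * Y) ^ (p - 2) * (√E * √Y) ^ (2 : ℝ) := by
          rw [Real.mul_rpow (by positivity) (by positivity), ← Real.rpow_mul (by positivity),
            ← Real.rpow_mul (by positivity), div_mul_cancel₀ _ hp.ne', sub_mul, one_mul,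
            div_mul_cancel₀ _ hp.ne']
      _ = (B ^ (p - 2) * E) * (Y ^ (p - 2) * Y) := by
          rw [Real.rpow_two, mul_pow, Real.sq_sqrt hE, Real.sq_sqrt hY, Real.mul_rpow hB hY]
          ring
      _ = (B ^ (p - 2) * E) * Y ^ (p - 1) := by
          rw [← Real.rpow_add_one hY₀.ne']
          ring_nf
  refine le_of_mul_le_mul_right ?_ (Real.rpow_pos_of_pos hY₀ (p - 1))
  rwa [mul_comm Y, ← Real.rpow_add_one hY₀.ne', sub_add_cancel]

theorem sum_norm_rpow_le_of_interpolation [Fintype ι] [Fintype κ] {B C : ℝ} (hB : 0 ≤ B)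
    (hC : 0 ≤ C) (hp : 2 ≤ p)
    (bound : ∀ F G, (∀ i, ‖F i‖ ≤ 1) → (∀ k, ‖G k‖ ≤ 1) → ∀ ω, ‖D F G ω‖ ≤ B)
    (bound_two : ∀ F G, ∑ ω, ‖D F G ω‖ ^ 2 ≤ C * (√(∑ i, ‖F i‖ ^ 4) * √(∑ k, ‖G k‖ ^ 4))) :
    ∑ ω, ‖D F G ω‖ ^ p ≤
      B ^ (p - 2) * (C * (√(∑ i, ‖F i‖ ^ (2 * p)) * √(∑ k, ‖G k‖ ^ (2 * p)))) := by
  have hp₀ : 0 < p := by linarith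
  have strip : ((2 / p : ℝ) : ℂ) ∈ verticalClosedStrip 0 1 :=
    ⟨by rw [Complex.ofReal_re]; positivity, by rwa [Complex.ofReal_re, div_le_one hp₀]⟩
  have threeLines := norm_le_interp_of_mem_verticalClosedStrip₀₁' (interpolant D p F G) strip
    (differentiable_interpolant D F G).diffContOnCl (bddAbove_norm_interpolant D F G hp₀.le)
    (fun z hz => norm_interpolant_le_of_re_eq_zero D F G bound hz)
    (fun z hz => norm_interpolant_le_of_re_eq_one D F G hC bound_two hz)
  rw [interpolant_two_div D F G hp₀.ne', Complex.norm_of_nonneg (by positivity),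
    Complex.ofReal_re] at threeLines
  exact le_mul_of_le_rpow_mul_rpow hp₀ (by positivity) hB (by positivity) threeLines

variable {V W : Type*} [AddCommGroup V] [AddCommGroup W]

/-- The successive differences of the double averages over `H 0, …, H m`, as a bilinear map. -/
def bilinAvgDifferences (σ τ : V →+ W) (H : ℕ → AddSubgroup V) [∀ j, Fintype (H j)] (m : ℕ) :
    (W → ℂ) →ₗ[ℂ] (W → ℂ) →ₗ[ℂ] (Fin m × W → ℂ) :=
  LinearMap.mk₂ ℂ
    (fun F G ω => bilinAvg σ τ (H ω.1) F G ω.2 - bilinAvg σ τ (H (ω.1 + 1)) F G ω.2)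
    (fun F F' G => funext fun ω => by
      simp only [bilinAvg, Pi.add_apply, add_mul, expect_add_distrib, add_sub_add_comm])
    (fun c F G => funext fun ω => by
      simp only [bilinAvg, Pi.smul_apply, smul_eq_mul, mul_assoc, ← mul_expect, mul_sub])
    (fun F G G' => funext fun ω => by
      simp only [bilinAvg, Pi.add_apply, mul_add, expect_add_distrib, add_sub_add_comm])
    (fun c F G => funext fun ω => by
      simp only [bilinAvg, Pi.smul_apply, smul_eq_mul, mul_left_comm _ c, ← mul_expect, mul_sub])

theorem sum_range_norm_bilinAvg_sub_rpow_le [Fintype W] (σ τ : V →+ W) {H : ℕ → AddSubgroup V}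
    [∀ j, Fintype (H j)] (hH : Monotone H) (hp : 2 ≤ p) (F G : W → ℂ) (m : ℕ) :
    ∑ j ∈ range m, ∑ w, ‖bilinAvg σ τ (H j) F G w - bilinAvg σ τ (H (j + 1)) F G w‖ ^ p ≤
      2 ^ (p - 2) * (3 * (√(∑ w, ‖F w‖ ^ (2 * p)) * √(∑ w, ‖G w‖ ^ (2 * p)))) := by
  have bound (F G : W → ℂ) (hF : ∀ w, ‖F w‖ ≤ 1) (hG : ∀ w, ‖G w‖ ≤ 1) (ω : Fin m × W) :
      ‖bilinAvgDifferences σ τ H m F G ω‖ ≤ 2 :=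
    (norm_sub_le_of_le (norm_bilinAvg_le_one σ τ hF hG _)
      (norm_bilinAvg_le_one σ τ hF hG _)).trans_eq one_add_one_eq_two
  have bound_two (F G : W → ℂ) : ∑ ω, ‖bilinAvgDifferences σ τ H m F G ω‖ ^ 2 ≤
      3 * (√(∑ w, ‖F w‖ ^ 4) * √(∑ w, ‖G w‖ ^ 4)) := by
    have := sum_range_norm_bilinAvg_sub_sq_le σ τ hH F G m
    rwa [sum_range, ← Fintype.sum_prod_type'] at this
  have := sum_norm_rpow_le_of_interpolation (bilinAvgDifferences σ τ H m) F G zero_le_two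
    zero_le_three hp bound bound_two
  rw [Fintype.sum_prod_type] at this
  rwa [sum_range]

end Interpolation

section SubgroupAverages

variable {G X : Type*} [AddCommGroup G]

/-- The double average of `f` and `g` over a finite subgroup `H` of the acting group. -/
def subgroupAverage (S T : G → X → X) (f g : X → ℂ) (H : AddSubgroup G) [Fintype H] (x : X) : ℂ :=
  𝔼 a : H, f (S a x) * g (T a x)

theorem subgroupAverage_eq (S T : G → X → X) (f g : X → ℂ) (H : AddSubgroup G) [Fintype H] :
    subgroupAverage S T f g H =
      fun x => (Fintype.card H : ℂ)⁻¹ * ∑ a : H, f (S a x) * g (T a x) := by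
  funext x
  rw [subgroupAverage, Fintype.expect_eq_sum_div_card, div_eq_inv_mul]

end SubgroupAverages

section Transference

variable {X : Type*} [MeasurableSpace X] {μ : Measure X}

theorem eLpNorm_ofReal_rpow {p : ℝ} (hp : 0 < p) (f : X → ℂ) :
    eLpNorm f (ENNReal.ofReal p) μ ^ p = ∫⁻ x, ‖f x‖ₑ ^ p ∂μ := by
  have := eLpNorm_nnreal_pow_eq_lintegral (μ := μ) (f := f) (Real.toNNReal_pos.2 hp).ne'
  rwa [Real.coe_toNNReal p hp.le] at this

theorem lintegral_rpow_two_mul_rpow_half {p : ℝ} (hp : 0 < p) (f : X → ℂ) :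
    (∫⁻ x, ‖f x‖ₑ ^ (2 * p) ∂μ) ^ (1 / 2 : ℝ) = eLpNorm f (ENNReal.ofReal (2 * p)) μ ^ p := by
  rw [← eLpNorm_ofReal_rpow (by positivity), ← ENNReal.rpow_mul]
  ring_nf

theorem sum_enorm_rpow_eq_ofReal {ι : Type*} (s : Finset ι) (F : ι → ℂ) {q : ℝ} (hq : 0 ≤ q) :
    ∑ i ∈ s, ‖F i‖ₑ ^ q = ENNReal.ofReal (∑ i ∈ s, ‖F i‖ ^ q) := by
  rw [ENNReal.ofReal_sum_of_nonneg fun i _ => by positivity]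
  exact sum_congr rfl fun i _ => by
    rw [← ofReal_norm, ENNReal.ofReal_rpow_of_nonneg (norm_nonneg _) hq]

theorem sum_enorm_rpow_rpow_half {ι : Type*} (s : Finset ι) (F : ι → ℂ) {q : ℝ} (hq : 0 ≤ q) :
    (∑ i ∈ s, ‖F i‖ₑ ^ q) ^ (1 / 2 : ℝ) = ENNReal.ofReal √(∑ i ∈ s, ‖F i‖ ^ q) := by
  rw [sum_enorm_rpow_eq_ofReal s F hq, Real.sqrt_eq_rpow,
    ENNReal.ofReal_rpow_of_nonneg (by positivity) (by positivity)]

theorem lintegral_sum_comp {ι : Type*} [Fintype ι] {R : ι → X → X}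
    (hR : ∀ i, MeasurePreserving (R i) μ μ) {u : X → ℝ≥0∞} (hu : AEMeasurable u μ) :
    ∫⁻ x, ∑ i, u (R i x) ∂μ = Fintype.card ι * ∫⁻ x, u x ∂μ := by
  have hcomp (i : ι) : ∫⁻ x, u (R i x) ∂μ = ∫⁻ x, u x ∂μ := by
    rw [← lintegral_map' ((hR i).map_eq.symm ▸ hu) (hR i).aemeasurable, (hR i).map_eq]
  have hmeas (i : ι) : AEMeasurable (fun x => u (R i x)) μ :=
    hu.comp_quasiMeasurePreserving (hR i).quasiMeasurePreserving
  rw [lintegral_finsetSum' _ fun i _ => hmeas i]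
  simp only [hcomp, sum_const, nsmul_eq_mul, card_univ]

theorem lintegral_le_of_sum_comp_le {ι : Type*} [Fintype ι] [Nonempty ι] {R : ι → X → X}
    (hR : ∀ i, MeasurePreserving (R i) μ μ) {φ u v : X → ℝ≥0∞} (hφ : AEMeasurable φ μ)
    (hu : AEMeasurable u μ) (hv : AEMeasurable v μ) {C : ℝ≥0∞}
    (h : ∀ x, ∑ i, φ (R i x) ≤
      C * ((∑ i, u (R i x)) ^ (1 / 2 : ℝ) * (∑ i, v (R i x)) ^ (1 / 2 : ℝ))) :
    ∫⁻ x, φ x ∂μ ≤ C * ((∫⁻ x, u x ∂μ) ^ (1 / 2 : ℝ) * (∫⁻ x, v x ∂μ) ^ (1 / 2 : ℝ)) := by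
  have aemeas {w : X → ℝ≥0∞} (hw : AEMeasurable w μ) :
      AEMeasurable (fun x => (∑ i, w (R i x)) ^ (1 / 2 : ℝ)) μ :=
    (Finset.aemeasurable_fun_sum _ fun i _ =>
      hw.comp_quasiMeasurePreserving (hR i).quasiMeasurePreserving).pow_const _
  have half_sq (t : ℝ≥0∞) : (t ^ (1 / 2 : ℝ)) ^ (2 : ℝ) = t := by
    rw [← ENNReal.rpow_mul, one_div_mul_cancel two_ne_zero, ENNReal.rpow_one]
  set c : ℝ≥0∞ := (Fintype.card ι : ℝ≥0∞)
  have cauchySchwarz := ENNReal.lintegral_mul_le_Lp_mul_Lq μ Real.HolderConjugate.two_two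
    (aemeas hu) (aemeas hv)
  simp only [half_sq, lintegral_sum_comp hR hu, lintegral_sum_comp hR hv, Pi.mul_apply]
    at cauchySchwarz
  have scaled : c * ∫⁻ x, φ x ∂μ ≤
      c * (C * ((∫⁻ x, u x ∂μ) ^ (1 / 2 : ℝ) * (∫⁻ x, v x ∂μ) ^ (1 / 2 : ℝ))) :=
    calc c * ∫⁻ x, φ x ∂μ = ∫⁻ x, ∑ i, φ (R i x) ∂μ := (lintegral_sum_comp hR hφ).symm
      _ ≤ C * ∫⁻ x, (∑ i, u (R i x)) ^ (1 / 2 : ℝ) * (∑ i, v (R i x)) ^ (1 / 2 : ℝ) ∂μ :=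
          (lintegral_mono h).trans_eq (lintegral_const_mul'' _ ((aemeas hu).mul (aemeas hv)))
      _ ≤ C * ((c * ∫⁻ x, u x ∂μ) ^ (1 / 2 : ℝ) * (c * ∫⁻ x, v x ∂μ) ^ (1 / 2 : ℝ)) := by
          gcongr
      _ = c * (C * ((∫⁻ x, u x ∂μ) ^ (1 / 2 : ℝ) * (∫⁻ x, v x ∂μ) ^ (1 / 2 : ℝ))) := by
          have hc : c ^ (1 / 2 : ℝ) * c ^ (1 / 2 : ℝ) = c := by
            rw [← ENNReal.rpow_add_of_nonneg _ _ (by positivity) (by positivity), add_halves,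
              ENNReal.rpow_one]
          rw [ENNReal.mul_rpow_of_nonneg _ _ (by positivity),
            ENNReal.mul_rpow_of_nonneg _ _ (by positivity), mul_mul_mul_comm, hc, mul_left_comm]
  exact (ENNReal.mul_le_mul_iff_right (by simp) (ENNReal.natCast_ne_top _)).1 scaled

variable {G : Type*} [AddCommGroup G]

/-- Two commuting measure preserving actions `S` and `T` of an abelian group. The transformations
`S 0` and `T 0` need not be the identity. -/
structure IsCommutingPair (μ : Measure X) (S T : G → X → X) : Prop where
  measurePreserving_left : ∀ a, MeasurePreserving (S a) μ μ
  measurePreserving_right : ∀ a, MeasurePreserving (T a) μ μ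
  left_add : ∀ a b x, S (a + b) x = S a (S b x)
  right_add : ∀ a b x, T (a + b) x = T a (T b x)
  commute : ∀ a b x, S a (T b x) = T b (S a x)

/-- The constant in the norm-variation estimate: interpolation between the `L⁴ × L⁴ → L²` bound with
constant `3` and the trivial bound `2` for differences of averages of bounded functions. -/
def variationConst (p : ℝ) : ℝ≥0 := (2 ^ (p - 2) * 3 : ℝ).toNNReal

variable {S T : G → X → X} {f g : X → ℂ}

theorem IsCommutingPair.bilinAvg_orbit (hST : IsCommutingPair μ S T) (f g : X → ℂ)
    {H N : AddSubgroup G} [Fintype H] [Fintype (H.addSubgroupOf N)] (h : H ≤ N) (x : X)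
    (w : N × N) :
    bilinAvg (.inl N N) (.inr N N) (H.addSubgroupOf N) (fun w => f (S w.1 (T w.2 x)))
      (fun w => g (S w.1 (T w.2 x))) w = subgroupAverage S T f g H (S w.1 (T w.2 x)) := by
  refine Fintype.expect_equiv (AddSubgroup.addSubgroupOfEquivOfLe h).toEquiv _ _ fun a => ?_
  have left : S (w.1 + a : N) (T w.2 x) = S a (S w.1 (T w.2 x)) := by
    rw [AddSubgroup.coe_add, add_comm, hST.left_add]
  have right : S w.1 (T (w.2 + a : N) x) = T a (S w.1 (T w.2 x)) := by
    rw [AddSubgroup.coe_add, add_comm, hST.right_add, hST.commute]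
  simp only [AddMonoidHom.inl_apply, AddMonoidHom.inr_apply, Prod.fst_add, Prod.snd_add, add_zero]
  rw [left, right]
  rfl

theorem IsCommutingPair.measurePreserving_orbit (hST : IsCommutingPair μ S T) (a b : G) :
    MeasurePreserving (fun x => S a (T b x)) μ μ :=
  (hST.measurePreserving_left a).comp (hST.measurePreserving_right b)

theorem IsCommutingPair.aestronglyMeasurable_subgroupAverage (hST : IsCommutingPair μ S T)
    (hf : AEStronglyMeasurable f μ) (hg : AEStronglyMeasurable g μ) (H : AddSubgroup G)
    [Fintype H] : AEStronglyMeasurable (subgroupAverage S T f g H) μ := by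
  have summand (a : G) : AEStronglyMeasurable (fun x => f (S a x) * g (T a x)) μ :=
    (hf.comp_measurePreserving (hST.measurePreserving_left a)).mul
      (hg.comp_measurePreserving (hST.measurePreserving_right a))
  rw [subgroupAverage_eq]
  exact (Finset.aestronglyMeasurable_fun_sum univ fun (a : H) _ => summand a).const_mul _

theorem IsCommutingPair.memLp_subgroupAverage (hST : IsCommutingPair μ S T) {p : ℝ} (hp : 0 < p)
    (hf : MemLp f (ENNReal.ofReal (2 * p)) μ) (hg : MemLp g (ENNReal.ofReal (2 * p)) μ)
    (H : AddSubgroup G) [Fintype H] :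
    MemLp (subgroupAverage S T f g H) (ENNReal.ofReal p) μ := by
  have : ENNReal.HolderTriple (ENNReal.ofReal (2 * p)) (ENNReal.ofReal (2 * p))
      (ENNReal.ofReal p) := ⟨by
    rw [← ENNReal.ofReal_inv_of_pos hp, ← ENNReal.ofReal_inv_of_pos (by positivity),
      ← ENNReal.ofReal_add (by positivity) (by positivity)]
    congr 1
    field_simp
    norm_num⟩
  have summand (a : G) : MemLp (fun x => f (S a x) * g (T a x)) (ENNReal.ofReal p) μ :=
    (hg.comp_measurePreserving (hST.measurePreserving_right a)).mul'
      (hf.comp_measurePreserving (hST.measurePreserving_left a))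
  rw [subgroupAverage_eq]
  exact (memLp_finsetSum univ fun (a : H) _ => summand a).const_mul _

variable {p : ℝ} {H : ℕ → AddSubgroup G} [∀ n, Fintype (H n)]

theorem IsCommutingPair.sum_orbit_le (hST : IsCommutingPair μ S T) (f g : X → ℂ) (hp : 2 ≤ p)
    (hH : Monotone H) (m : ℕ) (x : X) :
    ∑ w : H m × H m, ∑ j ∈ range m, ‖subgroupAverage S T f g (H j) (S w.1 (T w.2 x)) -
        subgroupAverage S T f g (H (j + 1)) (S w.1 (T w.2 x))‖ₑ ^ p ≤
      variationConst p * ((∑ w : H m × H m, ‖f (S w.1 (T w.2 x))‖ₑ ^ (2 * p)) ^ (1 / 2 : ℝ) *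
        (∑ w : H m × H m, ‖g (S w.1 (T w.2 x))‖ₑ ^ (2 * p)) ^ (1 / 2 : ℝ)) := by
  have hp₀ : 0 ≤ p := by linarith
  let K (j : ℕ) : AddSubgroup (H m) := (H j).addSubgroupOf (H m)
  have (j : ℕ) : Fintype (K j) := .ofFinite _
  have hK : Monotone K := fun i j hij => AddSubgroup.comap_mono (hH hij)
  have finite := sum_range_norm_bilinAvg_sub_rpow_le (.inl (H m) (H m)) (.inr (H m) (H m)) hK hp
    (fun w => f (S w.1 (T w.2 x))) (fun w => g (S w.1 (T w.2 x))) m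
  have orbit (j : ℕ) (hj : j ∈ range m) (w : H m × H m) :=
    congrArg₂ (fun y z : ℂ => ‖y - z‖ₑ ^ p)
      (hST.bilinAvg_orbit f g (hH (mem_range.1 hj).le) x w)
      (hST.bilinAvg_orbit f g (hH (mem_range.1 hj)) x w)
  rw [sum_comm, ← sum_congr rfl fun j hj => sum_congr rfl fun w _ => orbit j hj w,
    sum_enorm_rpow_rpow_half _ _ (by positivity), sum_enorm_rpow_rpow_half _ _ (by positivity),
    variationConst, ← ENNReal.ofReal, ← ENNReal.ofReal_mul (by positivity),
    ← ENNReal.ofReal_mul (by positivity), mul_assoc (2 ^ (p - 2))]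
  simp only [sum_enorm_rpow_eq_ofReal _ _ hp₀]
  rw [← ENNReal.ofReal_sum_of_nonneg fun j _ => by positivity]
  exact ENNReal.ofReal_le_ofReal finite

theorem IsCommutingPair.sum_eLpNorm_subgroupAverage_sub_le (hST : IsCommutingPair μ S T)
    (hf : AEStronglyMeasurable f μ) (hg : AEStronglyMeasurable g μ) (hp : 2 ≤ p)
    (hH : Monotone H) (m : ℕ) :
    ∑ j ∈ range m, eLpNorm (subgroupAverage S T f g (H j) - subgroupAverage S T f g (H (j + 1)))
        (ENNReal.ofReal p) μ ^ p ≤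
      variationConst p * (eLpNorm f (ENNReal.ofReal (2 * p)) μ ^ p *
        eLpNorm g (ENNReal.ofReal (2 * p)) μ ^ p) := by
  have hp₀ : 0 < p := by linarith
  have hdiff (j : ℕ) : AEMeasurable (fun x =>
      ‖(subgroupAverage S T f g (H j) - subgroupAverage S T f g (H (j + 1))) x‖ₑ ^ p) μ :=
    ((hST.aestronglyMeasurable_subgroupAverage hf hg (H j)).sub
      (hST.aestronglyMeasurable_subgroupAverage hf hg (H (j + 1)))).enorm.pow_const p
  simp only [eLpNorm_ofReal_rpow hp₀, ← lintegral_rpow_two_mul_rpow_half hp₀]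
  rw [← lintegral_finsetSum' _ fun j _ => hdiff j]
  exact lintegral_le_of_sum_comp_le (fun w : H m × H m => hST.measurePreserving_orbit w.1 w.2)
    (Finset.aemeasurable_fun_sum _ fun j _ => hdiff j) (hf.enorm.pow_const _)
    (hg.enorm.pow_const _) (hST.sum_orbit_le f g hp hH m)

end Transference

section Variation

theorem exists_strictMono_sum_eq {R : Type*} [AddCommMonoid R] {t : ℕ → ℕ → R}
    (ht : ∀ i, t i i = 0) {n : ℕ → ℕ} (hn : Monotone n) (m : ℕ) :
    ∃ (k : ℕ) (s : Fin (k + 1) → ℕ), StrictMono s ∧ s (Fin.last k) = n m ∧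
      ∑ j : Fin k, t (s j.castSucc) (s j.succ) = ∑ j ∈ range m, t (n j) (n (j + 1)) := by
  induction m with
  | zero => exact ⟨0, fun _ => n 0, Fin.strictMono_iff_lt_succ.2 fun i => i.elim0, rfl, by simp⟩
  | succ m ih =>
    obtain ⟨k, s, hs, hlast, hsum⟩ := ih
    rw [sum_range_succ, ← hsum]
    rcases (hn m.le_succ).eq_or_lt with h | h
    · exact ⟨k, s, hs, hlast.trans h, by rw [← h, ht, add_zero]⟩
    · refine ⟨k + 1, Fin.snoc s (n (m + 1)), Fin.strictMono_iff_lt_succ.2 fun i => ?_,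
        Fin.snoc_last _ _, ?_⟩
      · induction i using Fin.lastCases with
        | last => simpa [hlast] using h
        | cast i => simpa [← Fin.castSucc_succ] using hs i.castSucc_lt_succ
      · rw [Fin.sum_univ_castSucc]
        simp [← Fin.castSucc_succ, hlast]

theorem exists_monotone_interleaving {m : ℕ} {n n' : Fin m → ℕ} (h : ∀ j, n j < n' j)
    (h' : ∀ i j, i < j → n' i ≤ n j) :
    ∃ k : ℕ → ℕ, Monotone k ∧ ∀ j : Fin m, k (2 * j) = n j ∧ k (2 * j + 1) = n' j := by
  rcases m with _ | m
  · exact ⟨fun _ => 0, monotone_const, fun j => j.elim0⟩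
  let t (i : ℕ) : Fin (m + 1) := ⟨min (i / 2) m, by omega⟩
  have eq_of {a b : ℕ} (hab : min (a / 2) m = min (b / 2) m) : t a = t b := Fin.ext hab
  have even (j : Fin (m + 1)) : t (2 * j) = j := Fin.ext (by simp only [t]; omega)
  have odd (j : Fin (m + 1)) : t (2 * j + 1) = j := Fin.ext (by simp only [t]; omega)
  refine ⟨fun i => if i % 2 = 0 ∧ i / 2 ≤ m then n (t i) else n' (t i),
    monotone_nat_of_le_succ fun i => ?_, fun j => ⟨?_, ?_⟩⟩
  · split_ifs with h₁ h₂ h₂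
    · omega
    · rw [eq_of (a := i) (b := i + 1) (by omega)]
      exact (h _).le
    · exact h' _ _ (Fin.mk_lt_mk.2 (by omega))
    · rw [eq_of (a := i) (b := i + 1) (by omega)]
  · dsimp only
    rw [if_pos (by omega), even]
  · dsimp only
    rw [if_neg (by omega), odd]

theorem sum_range_even_le (t : ℕ → ℝ≥0∞) (m : ℕ) :
    ∑ j ∈ range m, t (2 * j) ≤ ∑ i ∈ range (2 * m), t i := by
  induction m with
  | zero => simp
  | succ m ih =>
    rw [sum_range_succ, mul_add, mul_one, sum_range_succ, sum_range_succ]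
    exact le_add_right (by gcongr)

variable {X : Type*} [MeasurableSpace X] {μ : Measure X} {p : ℝ} {M : ℕ → X → ℂ}

theorem sum_eLpNorm_sub_le_normVariation (hp : 0 < p) {n : ℕ → ℕ} (hn : Monotone n) (m : ℕ) :
    ∑ j ∈ range m, eLpNorm (M (n j) - M (n (j + 1))) (ENNReal.ofReal p) μ ^ p ≤
      normVariation μ p M := by
  let t (i j : ℕ) : ℝ≥0∞ := eLpNorm (M i - M j) (ENNReal.ofReal p) μ ^ p
  have ht (i : ℕ) : t i i = 0 := by simp [t, hp]
  obtain ⟨k, s, hs, -, hsum⟩ := exists_strictMono_sum_eq ht hn m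
  exact hsum.symm.trans_le (le_iSup₂_of_le k s (le_iSup_of_le hs le_rfl))

theorem normVariation_le_of_sum_range_le {R : ℝ≥0∞}
    (h : ∀ (n : ℕ → ℕ) (m : ℕ), Monotone n →
      ∑ j ∈ range m, eLpNorm (M (n j) - M (n (j + 1))) (ENNReal.ofReal p) μ ^ p ≤ R) :
    normVariation μ p M ≤ R := by
  refine iSup_le fun m => iSup_le fun s => iSup_le fun hs => ?_
  let n (i : ℕ) : ℕ := s ⟨min i m, by omega⟩
  have hn : Monotone n := fun i j hij => hs.monotone (Fin.mk_le_mk.2 (min_le_min_right m hij))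
  refine le_trans (le_of_eq ?_) (h n m hn)
  rw [sum_range]
  refine sum_congr rfl fun j _ => ?_
  have left : n j = s j.castSucc := congrArg s (Fin.ext (min_eq_left j.2.le))
  have right : n (j + 1) = s j.succ := congrArg s (Fin.ext (min_eq_left j.2))
  rw [left, right]

theorem HasJumps.mul_rpow_le_normVariation (hp : 0 < p) {ε : ℝ} {m : ℕ}
    (h : HasJumps μ p M ε m) : m * ENNReal.ofReal ε ^ p ≤ normVariation μ p M := by
  obtain ⟨n, n', hlt, hle, hε⟩ := h
  obtain ⟨k, hk, hkn⟩ := exists_monotone_interleaving hlt hle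
  let t (i : ℕ) : ℝ≥0∞ := eLpNorm (M (k i) - M (k (i + 1))) (ENNReal.ofReal p) μ ^ p
  calc m * ENNReal.ofReal ε ^ p = ∑ _j : Fin m, ENNReal.ofReal ε ^ p := by simp
    _ ≤ ∑ j : Fin m, t (2 * j) := sum_le_sum fun j _ => by
        simp only [t, hkn j]
        exact ENNReal.rpow_le_rpow (hε j) hp.le
    _ = ∑ j ∈ range m, t (2 * j) := (sum_range fun j => t (2 * j)).symm
    _ ≤ ∑ i ∈ range (2 * m), t i := sum_range_even_le t m
    _ ≤ normVariation μ p M := sum_eLpNorm_sub_le_normVariation hp hk (2 * m)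

theorem numJumps_le (hp : 0 < p) {ε : ℝ} (hε : 0 < ε) :
    (numJumps μ p M ε : ℝ≥0∞) ≤ ENNReal.ofReal (ε ^ (-p)) * normVariation μ p M := by
  have cancel : ENNReal.ofReal (ε ^ (-p)) * ENNReal.ofReal ε ^ p = 1 := by
    rw [ENNReal.ofReal_rpow_of_pos hε, ← ENNReal.ofReal_mul (by positivity), ← Real.rpow_add hε,
      neg_add_cancel, Real.rpow_zero, ENNReal.ofReal_one]
  simp only [numJumps, ENat.toENNReal_iSup, ENat.toENNReal_coe]
  refine iSup₂_le fun m hm => ?_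
  calc (m : ℝ≥0∞) = ENNReal.ofReal (ε ^ (-p)) * (m * ENNReal.ofReal ε ^ p) := by
        rw [mul_left_comm, cancel, mul_one]
    _ ≤ ENNReal.ofReal (ε ^ (-p)) * normVariation μ p M := by
        gcongr
        exact hm.mul_rpow_le_normVariation hp

theorem hasJumps_of_forall_exists {ε : ℝ}
    (h : ∀ N, ∃ n n', N ≤ n ∧ n < n' ∧
      ENNReal.ofReal ε ≤ eLpNorm (M n - M n') (ENNReal.ofReal p) μ) (m : ℕ) :
    HasJumps μ p M ε m := by
  choose a a' le_a a_lt jump using h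
  let N (j : ℕ) : ℕ := a'^[j] 0
  have N_succ (j : ℕ) : N (j + 1) = a' (N j) := Function.iterate_succ_apply' a' j 0
  have mono : Monotone N :=
    monotone_nat_of_le_succ fun j => by rw [N_succ]; exact (le_a _).trans (a_lt _).le
  refine ⟨fun j => a (N j), fun j => a' (N j), fun j => a_lt _, fun i j hij => ?_, fun j => jump _⟩
  calc a' (N i) = N (i + 1) := (N_succ i).symm
    _ ≤ N j := mono (Nat.succ_le_of_lt hij)
    _ ≤ a (N j) := le_a _

theorem cauchySeq_toLp_of_normVariation_ne_top [Fact (1 ≤ ENNReal.ofReal p)]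
    (hM : ∀ n, MemLp (M n) (ENNReal.ofReal p) μ) (h : normVariation μ p M ≠ ⊤) :
    CauchySeq fun n => (hM n).toLp := by
  have hp : 0 < p := zero_lt_one.trans_le (ENNReal.one_le_ofReal.1 Fact.out)
  let u (n : ℕ) : Lp ℂ (ENNReal.ofReal p) μ := (hM n).toLp
  change CauchySeq u
  rw [Metric.cauchySeq_iff]
  by_contra! hnot
  obtain ⟨ε, hε, hnot⟩ := hnot
  have large (i j : ℕ) (hij : ε ≤ dist (u i) (u j)) :
      ENNReal.ofReal ε ≤ eLpNorm (M i - M j) (ENNReal.ofReal p) μ := by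
    rw [← Lp.edist_toLp_toLp _ _ (hM i) (hM j), edist_dist]
    exact ENNReal.ofReal_le_ofReal hij
  have jumps := hasJumps_of_forall_exists (μ := μ) (p := p) (M := M) (ε := ε) fun N => by
    obtain ⟨i, hi, j, hj, hij⟩ := hnot N
    rcases lt_trichotomy i j with hlt | rfl | hlt
    · exact ⟨i, j, hi, hlt, large i j hij⟩
    · exact absurd (hij.trans_eq (dist_self (u i))) hε.not_ge
    · exact ⟨j, i, hj, hlt, large j i (hij.trans_eq (dist_comm _ _))⟩
  have hε₀ : ENNReal.ofReal ε ^ p ≠ 0 := (ENNReal.rpow_pos (by simpa) (by simp)).ne'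
  obtain ⟨m, hm⟩ := ENNReal.exists_nat_mul_gt hε₀ h
  exact hm.not_ge ((jumps m).mul_rpow_le_normVariation hp)

theorem exists_tendsto_of_normVariation_ne_top (hp : 1 ≤ p)
    (hM : ∀ n, MemLp (M n) (ENNReal.ofReal p) μ) (h : normVariation μ p M ≠ ⊤) :
    ∃ l : X → ℂ, MemLp l (ENNReal.ofReal p) μ ∧
      Tendsto (fun n => eLpNorm (M n - l) (ENNReal.ofReal p) μ) atTop (𝓝 0) := by
  have : Fact (1 ≤ ENNReal.ofReal p) := ⟨ENNReal.one_le_ofReal.2 hp⟩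
  obtain ⟨l, hl⟩ := cauchySeq_tendsto_of_complete (cauchySeq_toLp_of_normVariation_ne_top hM h)
  refine ⟨l, Lp.memLp l, ?_⟩
  rw [← Lp.toLp_coeFn l (Lp.memLp l)] at hl
  exact (Lp.tendsto_Lp_iff_tendsto_eLpNorm'' _ hM _ _).1 hl

theorem IsCommutingPair.normVariation_subgroupAverage_le {G : Type*} [AddCommGroup G]
    {S T : G → X → X} (hST : IsCommutingPair μ S T) {f g : X → ℂ}
    (hf : AEStronglyMeasurable f μ) (hg : AEStronglyMeasurable g μ) (hp : 2 ≤ p)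
    {H : ℕ → AddSubgroup G} [∀ n, Fintype (H n)] (hH : Monotone H) :
    normVariation μ p (fun n => subgroupAverage S T f g (H n)) ≤
      variationConst p * (eLpNorm f (ENNReal.ofReal (2 * p)) μ ^ p *
        eLpNorm g (ENNReal.ofReal (2 * p)) μ ^ p) :=
  normVariation_le_of_sum_range_le fun n m hn =>
    hST.sum_eLpNorm_subgroupAverage_sub_le (H := fun j => H (n j)) hf hg hp (hH.comp hn) m

end Variation

section Folner

variable {A : Type*} [AddCommGroup A]

/-- The subset `Φ_n` of `A^ω`, as a subgroup. -/
def folnerSubgroup (A : Type*) [AddCommGroup A] (n : ℕ) : AddSubgroup (Omega A) where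
  carrier := folnerSet A n
  zero_mem' _ _ := rfl
  add_mem' ha hb k hk := by rw [Finsupp.add_apply, ha k hk, hb k hk, add_zero]
  neg_mem' ha k hk := by rw [Finsupp.neg_apply, ha k hk, neg_zero]

theorem folnerSubgroup_mono : Monotone (folnerSubgroup A) :=
  fun _ _ h _ ha k hk => ha k (h.trans hk)

instance [Finite A] (n : ℕ) : Fintype (folnerSubgroup A n) := (folnerSet_finite A n).fintype

theorem doubleAverage_eq [Finite A] {X : Type*} (S T : Omega A → X → X) (f g : X → ℂ) :
    doubleAverage S T f g = fun n => subgroupAverage S T f g (folnerSubgroup A n) := by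
  funext n x
  rw [doubleAverage, subgroupAverage_eq]
  have mem_folner (a : Omega A) : a ∈ folner A n ↔ a ∈ folnerSubgroup A n :=
    Set.Finite.mem_toFinset _
  rw [sum_subtype _ mem_folner, ← Fintype.card_of_subtype _ mem_folner]

theorem IsMeasurePreservingAction.isCommutingPair {X : Type*} [MeasurableSpace X] {μ : Measure X}
    {S T : Omega A → X → X} (hS : IsMeasurePreservingAction μ S)
    (hT : IsMeasurePreservingAction μ T) (hST : ∀ a b, S a ∘ T b = T b ∘ S a) :
    IsCommutingPair μ S T where
  measurePreserving_left := hS.measurePreserving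
  measurePreserving_right := hT.measurePreserving
  left_add a b := congrFun (hS.map_add a b)
  right_add a b := congrFun (hT.map_add a b)
  commute a b := congrFun (hST a b)

end Folner

end DoubleAverages

end

theorem theorem1_general (p : ℝ) (hp : 2 ≤ p) :
    ∃ C : ℝ≥0,
      ∀ (G : Type*) [AddCommGroup G] (H : ℕ → AddSubgroup G) [∀ n, Fintype (H n)]
        (_hH : Monotone H) (X : Type*) [MeasurableSpace X] (μ : Measure X) (S T : G → X → X)
        (_hST : DoubleAverages.IsCommutingPair μ S T) (f g : X → ℂ)
        (_hf : AEStronglyMeasurable f μ) (_hg : AEStronglyMeasurable g μ),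
        DoubleAverages.normVariation μ p
            (fun n => DoubleAverages.subgroupAverage S T f g (H n)) ≤
            C * eLpNorm f (ENNReal.ofReal (2 * p)) μ ^ p *
              eLpNorm g (ENNReal.ofReal (2 * p)) μ ^ p ∧
        (∀ ε : ℝ, 0 < ε →
          (DoubleAverages.numJumps μ p
            (fun n => DoubleAverages.subgroupAverage S T f g (H n)) ε : ℝ≥0∞) ≤
            C * ENNReal.ofReal (ε ^ (-p)) * eLpNorm f (ENNReal.ofReal (2 * p)) μ ^ p *
              eLpNorm g (ENNReal.ofReal (2 * p)) μ ^ p) ∧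
        (MemLp f (ENNReal.ofReal (2 * p)) μ → MemLp g (ENNReal.ofReal (2 * p)) μ →
          (∀ n, MemLp (DoubleAverages.subgroupAverage S T f g (H n)) (ENNReal.ofReal p) μ) ∧
          ∃ h : X → ℂ, MemLp h (ENNReal.ofReal p) μ ∧
            Tendsto (fun n => eLpNorm (DoubleAverages.subgroupAverage S T f g (H n) - h)
              (ENNReal.ofReal p) μ) atTop (𝓝 0)) := by
  have hp₀ : 0 < p := by linarith
  refine ⟨DoubleAverages.variationConst p, fun G _ H _ hH X _ μ S T hST f g hf hg => ?_⟩
  have variation := hST.normVariation_subgroupAverage_le hf hg hp hH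
  refine ⟨by rwa [mul_assoc], fun ε hε => ?_, fun hfp hgp => ?_⟩
  · rw [mul_assoc, mul_comm (DoubleAverages.variationConst p : ℝ≥0∞), mul_assoc]
    exact (DoubleAverages.numJumps_le hp₀ hε).trans (mul_le_mul_right variation _)
  · have memLp n := hST.memLp_subgroupAverage hp₀ hfp hgp (H n)
    have finite := ENNReal.mul_ne_top (ENNReal.coe_ne_top (r := DoubleAverages.variationConst p)) <|
      ENNReal.mul_ne_top
      (ENNReal.rpow_ne_top_of_nonneg hp₀.le hfp.2.ne)
      (ENNReal.rpow_ne_top_of_nonneg hp₀.le hgp.2.ne)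
    exact ⟨memLp, DoubleAverages.exists_tendsto_of_normVariation_ne_top (by linarith) memLp
      (ne_top_of_le_ne_top finite variation)⟩

theorem theorem1 (p : ℝ) (hp : 2 ≤ p) :
    ∃ C : ℝ≥0,
      ∀ (A : Type*) [AddCommGroup A] [Finite A]
        (X : Type*) [MeasurableSpace X] [StandardBorelSpace X]
        (μ : Measure X) [IsProbabilityMeasure μ]
        (S T : DoubleAverages.Omega A → X → X)
        (_hS : DoubleAverages.IsMeasurePreservingAction μ S)
        (_hT : DoubleAverages.IsMeasurePreservingAction μ T)
        (_hST : ∀ a b, S a ∘ T b = T b ∘ S a)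
        (f g : X → ℂ) (_hf : Measurable f) (_hg : Measurable g),
        DoubleAverages.normVariation μ p (DoubleAverages.doubleAverage S T f g) ≤
            C * eLpNorm f (ENNReal.ofReal (2 * p)) μ ^ p *
              eLpNorm g (ENNReal.ofReal (2 * p)) μ ^ p ∧
        (∀ ε : ℝ, 0 < ε →
          (DoubleAverages.numJumps μ p (DoubleAverages.doubleAverage S T f g) ε : ℝ≥0∞) ≤
            C * ENNReal.ofReal (ε ^ (-p)) * eLpNorm f (ENNReal.ofReal (2 * p)) μ ^ p *
              eLpNorm g (ENNReal.ofReal (2 * p)) μ ^ p) ∧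
        (MemLp f (ENNReal.ofReal (2 * p)) μ → MemLp g (ENNReal.ofReal (2 * p)) μ →
          (∀ n, MemLp (DoubleAverages.doubleAverage S T f g n) (ENNReal.ofReal p) μ) ∧
          ∃ h : X → ℂ, MemLp h (ENNReal.ofReal p) μ ∧
            Tendsto (fun n => eLpNorm (DoubleAverages.doubleAverage S T f g n - h)
              (ENNReal.ofReal p) μ) atTop (𝓝 0)) :=
  (theorem1_general p hp).imp fun C hC A _ _ X _ _ μ _ S T hS hT hST f g hf hg => by
    simpa only [DoubleAverages.doubleAverage_eq] using hC (DoubleAverages.Omega A)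
      (DoubleAverages.folnerSubgroup A) DoubleAverages.folnerSubgroup_mono X μ S T
      (hS.isCommutingPair hT hST) f g hf.aestronglyMeasurable hg.aestronglyMeasurable
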